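/- Let $K=\mathbb F_q$ be a finite field with $q$ elements, let $s_i=(i\ \,i+1)\in S_n$ for $1\le i\le n-1$, let $\ell$ be the Coxeter length on $S_n$, and let $R=i_1i_2\cdots i_L$ be any word (not necessarily reduced) in the alphabet $\{1,\dots,n-1\}$. Let $B\subset \mathrm{GL}_n(K)$ be the group of invertible upper triangular matrices, acting on the set of complete flags $0=F_0\subset F_1\subset\cdots\subset F_n=K^n$, $\dim F_i=i$. For $w\in S_n$ let $X_w^\circ=B\cdot E_\bullet^w$ be the Schubert cell of the coordinate flag $E_i^w=\langle e_{w(1)},\dots,e_{w(i)}\rangle$, and let $E_\bullet=E_\bullet^{e}$ be the standard flag. Let $\mathrm{BS}^R$ be the Bott--Samelson variety over $K$, whose points are the sequences of complete flags $(F_\bullet^{(0)},\dots,F_\bullet^{(L)})$ with $F_\bullet^{(0)}=E_\bullet$ and $F_k^{(r-1)}=F_k^{(r)}$ for all $1\le r\le L$ and all $k\ne i_r$, and let $\pi_R$ be the projection to the last flag $F_\bullet^{(L)}$. Put $$\mathbb P_{R,q}(w)=\frac{|\pi_R^{-1}(X_w^\circ)|}{(q+1)^{L}},$$ where $|\cdot|$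 is the number of $\mathbb F_q$-points. A subword $T$ of $R$ is given by a set of positions $a_1<\cdots<a_m$ in $\{1,\dots,L\}$; put $w(T)=s_{i_{a_1}}\cdots s_{i_{a_m}}$. Starting from $x_0=e$, let $x_k=x_{k-1}s_{i_k}$ if the position $k$ is selected (that is, $k\in\{a_1,\dots,a_m\}$), and $x_k=x_{k-1}$ otherwise. The $k$-th decision is good if either $k$ is selected and $\ell(x_{k-1}s_{i_k})>\ell(x_{k-1})$, or $k$ is not selected and $\ell(x_{k-1}s_{i_k})<\ell(x_{k-1})$. Let $\mathrm{wt}_R(T)=q^{d}$, where $d$ is the number of good decisions among the $L$ decisions, and for $w\in S_n$ let $\mathrm{wt}_R(w)=\sum_{T:\,w(T)=w}\mathrm{wt}_R(T)$. Then for every $w\in S_n$, $$|\pi_R^{-1}(X_w^\circ)|=\mathrm{wt}_R(w),\qquad\text{and hence}\qquad \mathbb P_{R,q}(w)=\frac{\mathrm{wt}_R(w)}{(1+q)^{L}}.$$ -/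

import Mathlib

namespace BottSamelson

/-- The alphabet `{1, …, n - 1}`. -/
abbrev Letter (n : ℕ) : Type := {i : ℕ // 1 ≤ i ∧ i < n}

/-- The simple transposition `s_i = (i  i+1)` of `S_n`. Here `S_n` is `Equiv.Perm (Fin n)`, whose
letters are `0, …, n - 1`, so that `s_i` exchanges the elements `i - 1` and `i` of `Fin n`. -/
def simpleRefl {n : ℕ} (i : Letter n) : Equiv.Perm (Fin n) :=
  Equiv.swap ⟨i.1 - 1, by have := i.2; omega⟩ ⟨i.1, i.2.2⟩

/-- `w(R) = s_{i_1} s_{i_2} ⋯ s_{i_L}` for a word `R = i_1 i_2 ⋯ i_L`. -/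
def wordPerm {n : ℕ} (l : List (Letter n)) : Equiv.Perm (Fin n) :=
  (l.map simpleRefl).prod

/-- The Coxeter length `ℓ(w)`: the least length of a word in the simple transpositions whose
product is `w` (such words exist, see `exists_wordPerm_eq`). -/
noncomputable def coxeterLength {n : ℕ} (w : Equiv.Perm (Fin n)) : ℕ :=
  sInf {k : ℕ | ∃ l : List (Letter n), l.length = k ∧ wordPerm l = w}

theorem exists_wordPerm_eq {n : ℕ} (w : Equiv.Perm (Fin n)) :
    ∃ l : List (Letter n), wordPerm l = w := by
  cases n with
  | zero => exact ⟨[], Subsingleton.elim _ _⟩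
  | succ m =>
    have hw : w ∈ Submonoid.closure
        (Set.range fun i : Fin m => Equiv.swap i.castSucc i.succ) := by
      rw [Equiv.Perm.mclosure_swap_castSucc_succ]; trivial
    induction hw using Submonoid.closure_induction with
    | mem x hx =>
      obtain ⟨i, rfl⟩ := hx
      refine ⟨[⟨i.1 + 1, by omega, by omega⟩], ?_⟩
      simp only [wordPerm, List.map_cons, List.map_nil, List.prod_cons, List.prod_nil, mul_one,
        simpleRefl]
      rfl
    | one => exact ⟨[], rfl⟩
    | mul x y _ _ hx hy =>
      obtain ⟨l, rfl⟩ := hx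
      obtain ⟨l', rfl⟩ := hy
      exact ⟨l ++ l', by simp [wordPerm]⟩

/-! Weighted subwords. A word of length `L` is a map `R : Fin L → Letter n`, and a subword of `R` is
given by its set of positions `T : Finset (Fin L)`. -/

/-- The word `i_{a_1} ⋯ i_{a_m}` spelled by the positions `a_1 < ⋯ < a_m` in `T`. -/
def subwordList {n L : ℕ} (R : Fin L → Letter n) (T : Finset (Fin L)) : List (Letter n) :=
  ((List.finRange L).filter (fun k => k ∈ T)).map R

/-- The states `x_0, …, x_L`: `x_0 = e`, and the step at position `k` multiplies the current state
on the right by `s_{i_k}` if `k` is selected, and keeps it otherwise. -/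
def state {n L : ℕ} (R : Fin L → Letter n) (T : Finset (Fin L)) :
    Fin (L + 1) → Equiv.Perm (Fin n) :=
  Fin.induction 1 (fun k x => if k ∈ T then x * simpleRefl (R k) else x)

/-- The decision at position `k` is good: the letter is selected if and only if it increases the
length of the current state. -/
def IsGood {n L : ℕ} (R : Fin L → Letter n) (T : Finset (Fin L)) (k : Fin L) : Prop :=
  k ∈ T ↔ coxeterLength (state R T k.castSucc) <
    coxeterLength (state R T k.castSucc * simpleRefl (R k))

open Classical in
/-- The numbers `d_0, …, d_L` of good decisions among the first `0, …, L` ones. -/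
noncomputable def goodCount {n L : ℕ} (R : Fin L → Letter n) (T : Finset (Fin L)) :
    Fin (L + 1) → ℕ :=
  Fin.induction 0 (fun k d => if IsGood R T k then d + 1 else d)

/-- `wt_R(T) = q ^ d_L`. -/
noncomputable def subwordWeight {A : Type*} [CommSemiring A] (q : A) {n L : ℕ}
    (R : Fin L → Letter n) (T : Finset (Fin L)) : A :=
  q ^ goodCount R T (Fin.last L)

/-- `wt_R(x)`: the sum of `wt_R(T)` over the subwords `T` of `R` with `w(T) = x`. -/
noncomputable def weight {A : Type*} [CommSemiring A] (q : A) {n L : ℕ}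
    (R : Fin L → Letter n) (x : Equiv.Perm (Fin n)) : A :=
  ∑ T : Finset (Fin L) with wordPerm (subwordList R T) = x, subwordWeight q R T

/-- Complete flags `0 = F_0 ⊂ F_1 ⊂ ⋯ ⊂ F_n = K^n`, `dim F_i = i`. -/
@[ext]
structure CompleteFlag (K : Type*) [Field K] (n : ℕ) where
  space : Fin (n + 1) → Submodule K (Fin n → K)
  mono : Monotone space
  finrank_eq : ∀ i, Module.finrank K (space i) = i

/-- `GL_n(K)` acts on complete flags through its action on `K^n`. -/
instance flagMulAction {K : Type*} [Field K] {n : ℕ} :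
    MulAction (Matrix.GeneralLinearGroup (Fin n) K) (CompleteFlag K n) where
  smul g F :=
    { space := fun i => (F.space i).map (Matrix.toLin' (g : Matrix (Fin n) (Fin n) K))
      mono := fun _ _ h => Submodule.map_mono (F.mono h)
      finrank_eq := fun i => by
        have hinj : Function.Injective
            (Matrix.toLin' (g : Matrix (Fin n) (Fin n) K)) := by
          intro v w h
          have h' := congrArg (fun u => ((g⁻¹ : Matrix.GeneralLinearGroup (Fin n) K) :
            Matrix (Fin n) (Fin n) K).mulVec u) h
          simpa [Matrix.toLin'_apply, Matrix.mulVec_mulVec, ← Units.val_mul,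
            -Matrix.coe_units_inv] using h'
        rw [← (Submodule.equivMapOfInjective _ hinj (F.space i)).finrank_eq, F.finrank_eq] }
  one_smul F := by
    apply CompleteFlag.ext
    funext i
    change (F.space i).map (Matrix.toLin' (1 : Matrix (Fin n) (Fin n) K)) = F.space i
    rw [Matrix.toLin'_one, Submodule.map_id]
  mul_smul g h F := by
    apply CompleteFlag.ext
    funext i
    change (F.space i).map (Matrix.toLin'
      ((g : Matrix (Fin n) (Fin n) K) * (h : Matrix (Fin n) (Fin n) K))) =
      ((F.space i).map (Matrix.toLin' (h : Matrix (Fin n) (Fin n) K))).map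
        (Matrix.toLin' (g : Matrix (Fin n) (Fin n) K))
    rw [Matrix.toLin'_mul, Submodule.map_comp]

/-- The Borel subgroup `B` of invertible upper triangular matrices. -/
def borel (K : Type*) [Field K] (n : ℕ) : Subgroup (Matrix.GeneralLinearGroup (Fin n) K) where
  carrier := {g | ∀ i j : Fin n, j < i → (g : Matrix (Fin n) (Fin n) K) i j = 0}
  one_mem' := fun _ _ h => Matrix.one_apply_ne h.ne'
  mul_mem' := fun {a b} ha hb => by
    have ha' : Matrix.BlockTriangular (a : Matrix (Fin n) (Fin n) K) id := fun i j h => ha i j h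
    have hb' : Matrix.BlockTriangular (b : Matrix (Fin n) (Fin n) K) id := fun i j h => hb i j h
    exact fun i j h => (ha'.mul hb') h
  inv_mem' := fun {a} ha => by
    have ha' : Matrix.BlockTriangular (a : Matrix (Fin n) (Fin n) K) id := fun i j h => ha i j h
    intro i j h
    have : Invertible (a : Matrix (Fin n) (Fin n) K) := a.isUnit.invertible
    rw [Matrix.coe_units_inv]
    exact Matrix.blockTriangular_inv_of_blockTriangular ha' h

/-- The coordinate flag `E^w`, with `E^w_i = ⟨e_{w(1)}, …, e_{w(i)}⟩`. -/
def coordFlag (K : Type*) [Field K] {n : ℕ} (w : Equiv.Perm (Fin n)) : CompleteFlag K n where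
  space i := Submodule.span K
    ((fun j : Fin n => (Pi.single (w j) 1 : Fin n → K)) '' {j : Fin n | j.1 < i.1})
  mono := fun i j h => Submodule.span_mono
    (Set.image_mono fun k (hk : k.1 < i.1) => lt_of_lt_of_le hk h)
  finrank_eq := fun i => by
    have hli : LinearIndependent K (fun j : Fin n => (Pi.single (w j) 1 : Fin n → K)) := by
      have := (Pi.basisFun K (Fin n)).linearIndependent.comp w w.injective
      convert this using 1
      funext j
      simp
    have hs : (fun j : Fin n => (Pi.single (w j) 1 : Fin n → K)) '' {j : Fin n | j.1 < i.1} =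
        Set.range (fun j : {j : Fin n // j.1 < i.1} => (Pi.single (w j) 1 : Fin n → K)) := by
      ext v
      simp
    have hcard := finrank_span_eq_card
      (hli.comp (fun j : {j : Fin n // j.1 < i.1} => j.1) Subtype.val_injective)
    rw [Fintype.card_subtype] at hcard
    rw [hs]
    refine hcard.trans ?_
    simp [Fin.card_filter_val_lt, Nat.lt_succ_iff.1 i.2]

/-- The standard flag `E`, with `E_i = ⟨e_1, …, e_i⟩`. -/
def stdFlag (K : Type*) [Field K] (n : ℕ) : CompleteFlag K n := coordFlag K 1

/-- The Schubert cell `X_w° = B · E^w`. -/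
def schubertCell (K : Type*) [Field K] {n : ℕ} (w : Equiv.Perm (Fin n)) :
    Set (CompleteFlag K n) :=
  MulAction.orbit (borel K n) (coordFlag K w)

/-- The Bott–Samelson variety `BS^R` (its set of `K`-points): sequences of flags
`(F^(0), …, F^(L))` with `F^(0) = E`, such that `F^(r-1)` and `F^(r)` agree in every dimension
`k ≠ i_r`. -/
structure BSVariety (K : Type*) [Field K] {n L : ℕ} (R : Fin L → Letter n) where
  flag : Fin (L + 1) → CompleteFlag K n
  flag_zero : flag 0 = stdFlag K n
  flag_step : ∀ (r : Fin L) (k : Fin (n + 1)), k.1 ≠ (R r).1 →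
    (flag r.castSucc).space k = (flag r.succ).space k

/-- The Bott–Samelson map `π_R`, the projection to the last flag. -/
def bsMap (K : Type*) [Field K] {n L : ℕ} (R : Fin L → Letter n) (F : BSVariety K R) :
    CompleteFlag K n :=
  F.flag (Fin.last L)

/-- `P_{R,q}(w) = |π_R⁻¹(X_w°)| / (q + 1)^L` over a finite field `K` with `q` elements. -/
noncomputable def bsProb (K : Type*) [Field K] {n L : ℕ} (R : Fin L → Letter n)
    (w : Equiv.Perm (Fin n)) : ℝ :=
  ((bsMap K R ⁻¹' schubertCell K w).ncard : ℝ) / ((Nat.card K : ℝ) + 1) ^ L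

end BottSamelson

/-! Both sides obey the same recursion in the word. For the empty word each is `1` at `w = 1` and
`0` elsewhere. Appending a letter `i` gives `f_{Ri}(w) = c(w,i) (f_R(w) + f_R(w s_i))`, where
`c(w,i)` (`cellFactor`) is `q` if `w s_i` is shorter than `w` and `1` otherwise.

Weights (`weight_succ`): a subword ending at `w` was, before the last decision, at `w` (letter
skipped) or at `w s_i` (letter selected). In both cases that decision is good exactly when `w s_i`
is shorter than `w`.

Points (`ncard_preimage_succ`): forgetting the last flag leaves a point of the shorter variety with
last flag `F`, and the forgotten flag ranges over the projective line of flags differing from `F`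
only in dimension `i`. That line meets exactly two cells, those of some `x` and `x s_i`: the shorter
one in one point, the longer one in `q` points. Translation by `B` reduces this to lines through
coordinate flags, where transvections parametrize the `q` points.

The two sides are matched by `coxeterLength_lt_iff`, which turns the comparison of lengths into a
comparison of two values of `w`. -/

namespace BottSamelson

/-! ### Descents and the Coxeter length -/

/-- The position `i - 1` of `Fin n` exchanged by `s_i`. -/
def Letter.lo {n : ℕ} (i : Letter n) : Fin n := ⟨i.1 - 1, by have := i.2; omega⟩

/-- The position `i` of `Fin n` exchanged by `s_i`. -/
def Letter.hi {n : ℕ} (i : Letter n) : Fin n := ⟨i.1, i.2.2⟩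

variable {n : ℕ}

theorem Letter.lo_lt_hi (i : Letter n) : i.lo < i.hi := by
  have := i.2
  simp only [Letter.lo, Letter.hi, Fin.mk_lt_mk]
  omega

theorem simpleRefl_eq (i : Letter n) : simpleRefl i = Equiv.swap i.lo i.hi := rfl

@[simp] theorem simpleRefl_lo (i : Letter n) : simpleRefl i i.lo = i.hi :=
  Equiv.swap_apply_left _ _

@[simp] theorem simpleRefl_hi (i : Letter n) : simpleRefl i i.hi = i.lo :=
  Equiv.swap_apply_right _ _

theorem simpleRefl_of_ne (i : Letter n) {j : Fin n} (h₁ : j ≠ i.lo) (h₂ : j ≠ i.hi) :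
    simpleRefl i j = j :=
  Equiv.swap_apply_of_ne_of_ne h₁ h₂

@[simp] theorem simpleRefl_mul_self (i : Letter n) : simpleRefl i * simpleRefl i = 1 :=
  Equiv.swap_mul_self _ _

@[simp] theorem mul_simpleRefl_mul_simpleRefl (x : Equiv.Perm (Fin n)) (i : Letter n) :
    x * simpleRefl i * simpleRefl i = x := by
  rw [mul_assoc, simpleRefl_mul_self, mul_one]

/-- A simple transposition `s_a` reverses the order of two letters only if they are `a - 1, a`. -/
theorem eq_lo_hi_of_simpleRefl_lt (a : Letter n) {u v : Fin n} (huv : u < v)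
    (h : simpleRefl a v < simpleRefl a u) : u = a.lo ∧ v = a.hi := by
  have ha := a.2
  rw [simpleRefl_eq, Equiv.swap_apply_def, Equiv.swap_apply_def] at h
  have hlo : a.lo.1 = a.1 - 1 := rfl
  have hhi : a.hi.1 = a.1 := rfl
  simp only [Fin.ext_iff, Fin.lt_def] at *
  split_ifs at h <;> omega

/-- The exchange property at a descent. -/
theorem exists_wordPerm_of_descent (i : Letter n) (l : List (Letter n))
    (h : wordPerm l i.hi < wordPerm l i.lo) :
    ∃ l' : List (Letter n), l'.length + 1 = l.length ∧
      wordPerm l' = wordPerm l * simpleRefl i := by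
  induction l with
  | nil => exact absurd h (by simpa [wordPerm] using i.lo_lt_hi.le)
  | cons a l ih =>
    have hcons : ∀ m, wordPerm (a :: m) = simpleRefl a * wordPerm m := fun m => by
      simp [wordPerm]
    rw [hcons] at h ⊢
    rcases lt_or_gt_of_ne ((wordPerm l).injective.ne i.lo_lt_hi.ne) with hlt | hgt
    -- Here the leading `s_a` alone creates the descent, so `wordPerm l` carries the pair exchanged
    -- by `s_i` to the pair exchanged by `s_a`. Hence `s_a * wordPerm l = wordPerm l * s_i`, and
    -- deleting `a` is the exchange.
    · obtain ⟨hu, hv⟩ := eq_lo_hi_of_simpleRefl_lt a hlt h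
      refine ⟨l, rfl, ?_⟩
      have : wordPerm l * simpleRefl i = simpleRefl a * wordPerm l := by
        rw [simpleRefl_eq i, simpleRefl_eq a, ← hu, ← hv, Equiv.mul_swap_eq_swap_mul]
      rw [← this, mul_simpleRefl_mul_simpleRefl]
    · obtain ⟨l', hl, hw⟩ := ih hgt
      exact ⟨a :: l', by simp [hl], by rw [hcons, hw, mul_assoc]⟩

theorem coxeterLength_lt_of_descent (x : Equiv.Perm (Fin n)) (i : Letter n)
    (h : x i.hi < x i.lo) : coxeterLength (x * simpleRefl i) < coxeterLength x := by
  have hne : {k : ℕ | ∃ l : List (Letter n), l.length = k ∧ wordPerm l = x}.Nonempty := by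
    obtain ⟨l, hl⟩ := exists_wordPerm_eq x
    exact ⟨l.length, l, rfl, hl⟩
  obtain ⟨l, hl, rfl⟩ := Nat.sInf_mem hne
  obtain ⟨l', hl', hw⟩ := exists_wordPerm_of_descent i l h
  have hle : coxeterLength (wordPerm l * simpleRefl i) ≤ l'.length :=
    Nat.sInf_le ⟨l', rfl, hw⟩
  have hx : coxeterLength (wordPerm l) = l.length := hl.symm
  omega

/-- At a descent, exchange in a minimal word shortens `x`; at an ascent, `x * s_i` has a descent, so
the same argument applies to it. -/
theorem coxeterLength_lt_iff (x : Equiv.Perm (Fin n)) (i : Letter n) :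
    coxeterLength x < coxeterLength (x * simpleRefl i) ↔ x i.lo < x i.hi := by
  constructor
  · intro h
    by_contra hlt
    have := coxeterLength_lt_of_descent x i
      (lt_of_le_of_ne (not_lt.1 hlt) (x.injective.ne i.lo_lt_hi.ne'))
    omega
  · intro h
    simpa using coxeterLength_lt_of_descent (x * simpleRefl i) i (by simpa using h)

/-- The number of flags in the Schubert cell of `w` on a line of type `i` that meets it: `q` at a
descent and `1` at an ascent. -/
def cellFactor {A : Type*} [CommSemiring A] (q : A) (w : Equiv.Perm (Fin n)) (i : Letter n) : A :=
  if w i.lo < w i.hi then 1 else q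

/-! ### The recursion for the weights -/

variable {L : ℕ}

theorem state_succ (R : Fin L → Letter n) (T : Finset (Fin L)) (k : Fin L) :
    state R T k.succ =
      if k ∈ T then state R T k.castSucc * simpleRefl (R k) else state R T k.castSucc :=
  Fin.induction_succ _ _ _

open Classical in
theorem goodCount_succ (R : Fin L → Letter n) (T : Finset (Fin L)) (k : Fin L) :
    goodCount R T k.succ =
      if IsGood R T k then goodCount R T k.castSucc + 1 else goodCount R T k.castSucc := by
  rw [goodCount, Fin.induction_succ]
  rfl

/-- The truncation `T'` enters through a membership criterion, so the lemma serves both for `T`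
containing the last position and for `T` omitting it. -/
theorem state_castSucc (R : Fin (L + 1) → Letter n) (T : Finset (Fin (L + 1)))
    (T' : Finset (Fin L)) (h : ∀ k, k ∈ T' ↔ k.castSucc ∈ T) (j : Fin (L + 1)) :
    state R T j.castSucc = state (fun k => R k.castSucc) T' j := by
  induction j using Fin.induction with
  | zero => rfl
  | succ k ih =>
    rw [state_succ, ← Fin.succ_castSucc, state_succ, ih]
    simp only [h]

open Classical in
theorem goodCount_castSucc (R : Fin (L + 1) → Letter n) (T : Finset (Fin (L + 1)))
    (T' : Finset (Fin L)) (h : ∀ k, k ∈ T' ↔ k.castSucc ∈ T) (j : Fin (L + 1)) :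
    goodCount R T j.castSucc = goodCount (fun k => R k.castSucc) T' j := by
  induction j using Fin.induction with
  | zero => rfl
  | succ k ih =>
    have hg : IsGood R T k.castSucc ↔ IsGood (fun k => R k.castSucc) T' k := by
      rw [IsGood, IsGood, h, state_castSucc R T T' h]
    rw [goodCount_succ, ← Fin.succ_castSucc, goodCount_succ, ih]
    exact if_congr hg rfl rfl

theorem wordPerm_subwordList (R : Fin L → Letter n) (T : Finset (Fin L)) :
    wordPerm (subwordList R T) = state R T (Fin.last L) := by
  induction L with
  | zero => simp [subwordList, wordPerm, state]
  | succ L ih =>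
    let T' : Finset (Fin L) := Finset.univ.filter fun k => k.castSucc ∈ T
    have h : ∀ k, k ∈ T' ↔ k.castSucc ∈ T := by simp [T']
    have hl : subwordList R T = subwordList (fun k => R k.castSucc) T' ++
        if Fin.last L ∈ T then [R (Fin.last L)] else [] := by
      rw [subwordList, List.finRange_succ_last, List.filter_append, List.map_append,
        List.filter_map, List.map_map, subwordList]
      congr 1
      · congr 1
        apply List.filter_congr
        intro k _
        simp [h]
      · split_ifs with hT <;> simp [hT]
    have hs : wordPerm (subwordList (fun k => R k.castSucc) T') =
        state R T (Fin.last L).castSucc := by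
      rw [ih, state_castSucc R T T' h]
    rw [← Fin.succ_last, state_succ, hl, ← hs]
    split_ifs <;> simp [wordPerm]

/-- Subwords of a word of length `L + 1`, according to whether the last letter is selected. -/
theorem sum_finset_fin_succ {A : Type*} [AddCommMonoid A] (f : Finset (Fin (L + 1)) → A) :
    ∑ T, f T = ∑ T : Finset (Fin L), f (T.map Fin.castSuccEmb) +
      ∑ T : Finset (Fin L), f (insert (Fin.last L) (T.map Fin.castSuccEmb)) := by
  have hu : (Finset.univ : Finset (Fin (L + 1))) =
      insert (Fin.last L) (Finset.univ.map Fin.castSuccEmb) := by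
    ext k
    induction k using Fin.lastCases <;> simp
  have hm : (Finset.univ.map (Fin.castSuccEmb (n := L))).powerset =
      (Finset.univ : Finset (Finset (Fin L))).map
        ⟨fun T => T.map Fin.castSuccEmb, Finset.map_injective _⟩ := by
    ext T
    simp [Finset.subset_map_iff, eq_comm]
  rw [← Finset.powerset_univ, hu, Finset.sum_powerset_insert (by simp), hm, Finset.sum_map,
    Finset.sum_map]
  rfl

/-- The last decision is judged at the state before it, but its quality depends only on the state
after it: selecting the letter swaps the two compared values, skipping it keeps them, and either is
good exactly when the final state has a descent. -/
theorem subwordWeight_succ {A : Type*} [CommSemiring A] (q : A) (R : Fin (L + 1) → Letter n)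
    (T : Finset (Fin (L + 1))) (T' : Finset (Fin L)) (h : ∀ k, k ∈ T' ↔ k.castSucc ∈ T) :
    subwordWeight q R T = subwordWeight q (fun k => R k.castSucc) T' *
      cellFactor q (wordPerm (subwordList R T)) (R (Fin.last L)) := by
  rw [wordPerm_subwordList, subwordWeight, subwordWeight, ← Fin.succ_last, goodCount_succ,
    goodCount_castSucc R T T' h, state_succ, cellFactor, IsGood, coxeterLength_lt_iff]
  set x := state R T (Fin.last L).castSucc
  have hx : x (R (Fin.last L)).lo ≠ x (R (Fin.last L)).hi :=
    x.injective.ne (R (Fin.last L)).lo_lt_hi.ne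
  rcases lt_or_gt_of_ne hx with hlt | hlt <;> by_cases hT : Fin.last L ∈ T <;>
    simp [hT, hlt, hlt.not_gt, pow_succ]

theorem weight_succ {A : Type*} [CommSemiring A] (q : A) (R : Fin (L + 1) → Letter n)
    (w : Equiv.Perm (Fin n)) :
    weight q R w = cellFactor q w (R (Fin.last L)) *
      (weight q (fun k => R k.castSucc) w +
        weight q (fun k => R k.castSucc) (w * simpleRefl (R (Fin.last L)))) := by
  have h₀ : ∀ (T : Finset (Fin L)) (k : Fin L), k ∈ T ↔ k.castSucc ∈ T.map Fin.castSuccEmb := by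
    simp
  have h₁ : ∀ (T : Finset (Fin L)) (k : Fin L),
      k ∈ T ↔ k.castSucc ∈ insert (Fin.last L) (T.map Fin.castSuccEmb) := by
    simp
  have hw : ∀ x : Equiv.Perm (Fin n), x * simpleRefl (R (Fin.last L)) = w ↔
      x = w * simpleRefl (R (Fin.last L)) := fun x =>
    ⟨fun h => by simp [← h], fun h => by simp [h]⟩
  have key : ∀ (T : Finset (Fin (L + 1))) (T' : Finset (Fin L)),
      (∀ k, k ∈ T' ↔ k.castSucc ∈ T) →
      (if wordPerm (subwordList R T) = w then subwordWeight q R T else 0) =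
        cellFactor q w (R (Fin.last L)) * if wordPerm (subwordList R T) = w then
          subwordWeight q (fun k => R k.castSucc) T' else 0 := by
    intro T T' h
    split_ifs with hT
    · rw [subwordWeight_succ q R T T' h, hT, mul_comm]
    · simp
  simp only [weight, Finset.sum_filter]
  rw [sum_finset_fin_succ, mul_add, Finset.mul_sum, Finset.mul_sum]
  congr 1 <;> refine Finset.sum_congr rfl fun T _ => ?_
  · rw [key _ T (h₀ T), wordPerm_subwordList, wordPerm_subwordList, ← Fin.succ_last, state_succ,
      state_castSucc R _ T (h₀ T)]
    simp
  · rw [key _ T (h₁ T), wordPerm_subwordList, wordPerm_subwordList, ← Fin.succ_last, state_succ,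
      state_castSucc R _ T (h₁ T)]
    simp [hw]

theorem weight_zero {A : Type*} [CommSemiring A] (q : A) (R : Fin 0 → Letter n)
    (w : Equiv.Perm (Fin n)) : weight q R w = if w = 1 then 1 else 0 := by
  simp [weight, subwordList, wordPerm, subwordWeight, goodCount, eq_comm, apply_ite Finset.card]

theorem weight_natCast {A : Type*} [CommSemiring A] (q : ℕ) (R : Fin L → Letter n)
    (w : Equiv.Perm (Fin n)) : weight (q : A) R w = (weight q R w : ℕ) := by
  simp [weight, subwordWeight]

end BottSamelson

namespace BottSamelson

/-! ### Coordinate flags and Schubert cells -/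

variable {K : Type*} [Field K] {n : ℕ}

theorem mem_coordFlag (w : Equiv.Perm (Fin n)) (i : Fin (n + 1)) (v : Fin n → K) :
    v ∈ (coordFlag K w).space i ↔ ∀ j : Fin n, i.1 ≤ j.1 → v (w j) = 0 := by
  constructor
  · intro hv j hj
    refine Submodule.span_induction ?_ rfl ?_ ?_ hv
    · rintro _ ⟨k, hk, rfl⟩
      have hk : k.1 < i.1 := hk
      have : w j ≠ w k := w.injective.ne (by rintro rfl; omega)
      simp [this]
    · intro x y _ _ hx hy
      simp [hx, hy]
    · intro a x _ hx
      simp [hx]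
  · intro h
    have hv : v = ∑ j, v (w j) • (Pi.single (w j) 1 : Fin n → K) := by
      rw [Equiv.sum_comp w fun m => v m • (Pi.single m 1 : Fin n → K)]
      exact pi_eq_sum_univ' v
    rw [hv]
    refine Submodule.sum_mem _ fun j _ => ?_
    by_cases hj : j.1 < i.1
    · exact Submodule.smul_mem _ _ (Submodule.subset_span ⟨j, hj, rfl⟩)
    · rw [h j (not_lt.1 hj), zero_smul]
      exact Submodule.zero_mem _

theorem smul_space (g : Matrix.GeneralLinearGroup (Fin n) K) (F : CompleteFlag K n)
    (i : Fin (n + 1)) :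
    (g • F).space i = (F.space i).map (Matrix.toLin' (g : Matrix (Fin n) (Fin n) K)) := rfl

theorem smul_coordFlag_le_iff (g : Matrix.GeneralLinearGroup (Fin n) K)
    (w : Equiv.Perm (Fin n)) (i : Fin (n + 1)) (p : Submodule K (Fin n → K)) :
    (g • coordFlag K w).space i ≤ p ↔ ∀ j : Fin n, j.1 < i.1 →
      (g : Matrix (Fin n) (Fin n) K).mulVec (Pi.single (w j) 1) ∈ p := by
  rw [smul_space, Submodule.map_le_iff_le_comap, coordFlag, Submodule.span_le]
  simp [Set.subset_def]

theorem coordFlag_le_iff (w : Equiv.Perm (Fin n)) (i : Fin (n + 1))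
    (p : Submodule K (Fin n → K)) :
    (coordFlag K w).space i ≤ p ↔ ∀ j : Fin n, j.1 < i.1 → (Pi.single (w j) 1 : Fin n → K) ∈ p := by
  rw [coordFlag, Submodule.span_le]
  simp [Set.subset_def]

theorem CompleteFlag.space_eq_of_le {F G : CompleteFlag K n} {i : Fin (n + 1)}
    (h : F.space i ≤ G.space i) : F.space i = G.space i :=
  Submodule.eq_of_le_of_finrank_eq h (by rw [F.finrank_eq, G.finrank_eq])

theorem mem_schubertCell {w : Equiv.Perm (Fin n)} {F : CompleteFlag K n} :
    F ∈ schubertCell K w ↔ ∃ b ∈ borel K n, b • coordFlag K w = F := by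
  simp [schubertCell, MulAction.mem_orbit_iff, Subgroup.smul_def]

theorem coordFlag_mem_schubertCell (w : Equiv.Perm (Fin n)) :
    coordFlag K w ∈ schubertCell K w :=
  mem_schubertCell.2 ⟨1, one_mem _, one_smul _ _⟩

theorem smul_mem_schubertCell_iff {b : Matrix.GeneralLinearGroup (Fin n) K} (hb : b ∈ borel K n)
    {w : Equiv.Perm (Fin n)} {F : CompleteFlag K n} :
    b • F ∈ schubertCell K w ↔ F ∈ schubertCell K w := by
  simp only [mem_schubertCell]
  constructor
  · rintro ⟨c, hc, h⟩
    exact ⟨b⁻¹ * c, mul_mem (inv_mem hb) hc, by rw [mul_smul, h, inv_smul_smul]⟩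
  · rintro ⟨c, hc, rfl⟩
    exact ⟨b * c, mul_mem hb hc, mul_smul _ _ _⟩

theorem borel_diag_ne_zero {b : Matrix.GeneralLinearGroup (Fin n) K} (hb : b ∈ borel K n)
    (i : Fin n) : (b : Matrix (Fin n) (Fin n) K) i i ≠ 0 := by
  have hdet := (Matrix.isUnit_iff_isUnit_det _).1 b.isUnit
  rw [Matrix.det_of_isUpperTriangular (fun i j h => hb i j h), isUnit_iff_ne_zero,
    Finset.prod_ne_zero_iff] at hdet
  exact hdet i (Finset.mem_univ i)

/-- If `σ j < j`, then `σ` already fixes `σ j` by induction, and injectivity gives `σ j = j`. -/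
theorem perm_eq_one_of_le (σ : Equiv.Perm (Fin n)) (h : ∀ j, σ j ≤ j) : σ = 1 := by
  refine Equiv.ext fun j => ?_
  induction j using WellFoundedLT.induction with
  | ind j ih =>
    rcases (h j).eq_or_lt with hj | hj
    · exact hj
    · exact σ.injective (ih _ hj)

/-- Distinct Schubert cells are disjoint. -/
theorem schubertCell_disjoint {x y : Equiv.Perm (Fin n)} {F : CompleteFlag K n}
    (hx : F ∈ schubertCell K x) (hy : F ∈ schubertCell K y) : x = y := by
  obtain ⟨a, ha, rfl⟩ := mem_schubertCell.1 hx
  obtain ⟨b, hb, h⟩ := mem_schubertCell.1 ((smul_mem_schubertCell_iff ha).1 hy)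
  suffices x⁻¹ * y = 1 from inv_mul_eq_one.1 this
  refine perm_eq_one_of_le _ fun j => ?_
  by_contra hlt
  -- The vector `b e_{y(j)}` lies in the span of `e_{x(0)}, …, e_{x(j)}`, yet its coordinate at
  -- `y(j)` is a diagonal entry of `b`, hence nonzero. So `y(j)` is one of `x(0), …, x(j)`.
  have hle : (b • coordFlag K y).space j.succ ≤ (coordFlag K x).space j.succ := by rw [h]
  have hmem := (smul_coordFlag_le_iff _ _ _ _).1 hle j (by simp)
  have h0 := (mem_coordFlag _ _ _).1 hmem ((x⁻¹ * y) j)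
    (Nat.succ_le_of_lt (not_le.1 hlt))
  exact borel_diag_ne_zero hb (y j) (by simpa using h0)

/-! ### Lines of flags -/

/-- Two flags agree in every dimension `k ≠ i`. -/
def Adjacent (i : Letter n) (F G : CompleteFlag K n) : Prop :=
  ∀ k : Fin (n + 1), k.1 ≠ i.1 → F.space k = G.space k

theorem Adjacent.symm {i : Letter n} {F G : CompleteFlag K n} (h : Adjacent i F G) :
    Adjacent i G F := fun k hk => (h k hk).symm

theorem Adjacent.trans {i : Letter n} {F G H : CompleteFlag K n} (h : Adjacent i F G)
    (h' : Adjacent i G H) : Adjacent i F H := fun k hk => (h k hk).trans (h' k hk)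

theorem Adjacent.smul {i : Letter n} {F G : CompleteFlag K n} (h : Adjacent i F G)
    (g : Matrix.GeneralLinearGroup (Fin n) K) : Adjacent i (g • F) (g • G) := fun k hk => by
  rw [smul_space, smul_space, h k hk]

/-- The elementary matrix `1 + c e_{pr}` as an element of `GL_n(K)`. -/
noncomputable def transvectionUnit {p r : Fin n} (h : p ≠ r) (c : K) : Matrix.GeneralLinearGroup (Fin n) K :=
  Matrix.GeneralLinearGroup.mk'' (Matrix.transvection p r c)
    (by rw [Matrix.det_transvection_of_ne _ _ h]; exact isUnit_one)

theorem transvectionUnit_mulVec {p r : Fin n} (h : p ≠ r) (c : K) (v : Fin n → K) :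
    (transvectionUnit h c : Matrix (Fin n) (Fin n) K).mulVec v = v + Pi.single p (c * v r) := by
  change (Matrix.transvection p r c).mulVec v = _
  rw [Matrix.transvection, Matrix.add_mulVec, Matrix.one_mulVec, Matrix.single_mulVec]
  rfl

theorem transvectionUnit_mem_borel {p r : Fin n} (h : p < r) (c : K) :
    transvectionUnit h.ne c ∈ borel K n := by
  intro a b hab
  change Matrix.transvection p r c a b = 0
  rw [Matrix.transvection, Matrix.add_apply, Matrix.one_apply_ne hab.ne', zero_add,
    Matrix.single_apply, if_neg]
  rintro ⟨rfl, rfl⟩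
  exact absurd h hab.not_gt

section Line

variable (z : Equiv.Perm (Fin n)) (i : Letter n)

/-- The flags other than `E^z` on the line of type `i` through `E^z`. -/
noncomputable def lineFlag (c : K) : CompleteFlag K n :=
  transvectionUnit (z.injective.ne i.lo_lt_hi.ne) c • coordFlag K (z * simpleRefl i)

theorem adjacent_lineFlag (c : K) : Adjacent i (lineFlag z i c) (coordFlag K z) := by
  intro k hk
  apply CompleteFlag.space_eq_of_le
  rw [lineFlag, smul_coordFlag_le_iff]
  intro j hj
  rw [transvectionUnit_mulVec, mem_coordFlag]
  intro m hm
  have hi := i.2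
  have hlo : i.lo.1 = i.1 - 1 := rfl
  have hhi : i.hi.1 = i.1 := rfl
  -- For `k ≠ i`, `s_i` preserves the set of positions below `k`; here `j < k ≤ m`.
  have hmj : m ≠ simpleRefl i j := by
    rintro rfl
    by_cases h₁ : j = i.lo
    · subst h₁
      rw [simpleRefl_lo] at hm
      omega
    by_cases h₂ : j = i.hi
    · subst h₂
      rw [simpleRefl_hi] at hm
      omega
    rw [simpleRefl_of_ne i h₁ h₂] at hm
    omega
  have hzm : z m ≠ z (simpleRefl i j) := z.injective.ne hmj
  by_cases h₁ : j = i.lo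
  · subst h₁
    have hlo : z m ≠ z i.lo := z.injective.ne (by rintro rfl; omega)
    simp_all
  · have : z i.hi ≠ z (simpleRefl i j) := by
      rw [← simpleRefl_lo]
      exact z.injective.ne ((simpleRefl i).injective.ne (Ne.symm h₁))
    simp [hzm, this]

theorem lineFlag_le (c : K) (p : Submodule K (Fin n → K))
    (hp : ∀ j : Fin n, j.1 < i.1 - 1 → (Pi.single (z j) 1 : Fin n → K) ∈ p)
    (hc : Pi.single (z i.hi) 1 + Pi.single (z i.lo) c ∈ p) :
    (lineFlag z i c).space ⟨i.1, by have := i.2; omega⟩ ≤ p := by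
  rw [lineFlag, smul_coordFlag_le_iff]
  intro j hj
  have hi := i.2
  rw [transvectionUnit_mulVec]
  by_cases h₁ : j = i.lo
  · subst h₁
    simpa using hc
  · have hj' : j.1 < i.1 - 1 := by
      have : j.1 ≠ i.1 - 1 := fun h => h₁ (Fin.ext h)
      simp only at hj
      omega
    have h₂ : j ≠ i.hi := by
      rintro rfl
      simp only [Letter.hi] at hj'
      omega
    have : z i.hi ≠ z j := z.injective.ne (Ne.symm h₂)
    simpa [simpleRefl_of_ne i h₁ h₂, this] using hp j hj'

/-- In dimension `i` the flag with parameter `d` contains, modulo the `e_{z(j)}` with `j < i - 1`,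
only multiples of `e_{z(hi)} + d e_{z(lo)}`, so the parameter is a ratio of coordinates. -/
theorem lineFlag_injective : Function.Injective (lineFlag (K := K) z i) := by
  intro c d h
  have hi := i.2
  let m : Fin (n + 1) := ⟨i.1, by omega⟩
  have hle : (lineFlag z i c).space m ≤ (lineFlag z i d).space m := by rw [h]
  rw [lineFlag, smul_coordFlag_le_iff] at hle
  have hlo := hle i.lo i.lo_lt_hi
  rw [transvectionUnit_mulVec] at hlo
  obtain ⟨x, hx, hxe⟩ := hlo
  have hx₀ : x (z i.lo) = 0 := by
    simpa using (mem_coordFlag _ _ _).1 hx i.hi le_rfl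
  rw [Matrix.toLin'_apply, transvectionUnit_mulVec] at hxe
  have hne : z i.lo ≠ z i.hi := z.injective.ne i.lo_lt_hi.ne
  have h₁ : x (z i.hi) = 1 := by simpa [hne.symm] using congrFun hxe (z i.hi)
  simpa [hne, hx₀, h₁] using (congrFun hxe (z i.lo)).symm

/-- `G` is determined by its space of dimension `i`, which lies between the spaces of `E^z` of
dimensions `i - 1` and `i + 1`, so it is a point of a projective line: infinity gives `E^z`, the
affine points give `lineFlag`. -/
theorem eq_coordFlag_or_eq_lineFlag {G : CompleteFlag K n} (h : Adjacent i G (coordFlag K z)) :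
    G = coordFlag K z ∨ ∃ c, G = lineFlag z i c := by
  have hi := i.2
  let m : Fin (n + 1) := ⟨i.1, by omega⟩
  let m₀ : Fin (n + 1) := ⟨i.1 - 1, by omega⟩
  let m₁ : Fin (n + 1) := ⟨i.1 + 1, by omega⟩
  have hext : ∀ H : CompleteFlag K n, Adjacent i G H → G.space m = H.space m → G = H := by
    intro H hH hm
    ext1
    funext k
    by_cases hk : k.1 = i.1
    · obtain rfl : k = m := Fin.ext hk
      exact hm
    · exact hH k hk
  by_cases hle : G.space m ≤ (coordFlag K z).space m
  · exact Or.inl (hext _ h (CompleteFlag.space_eq_of_le hle))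
  right
  obtain ⟨v, hv, hvz⟩ := Set.not_subset.1 hle
  have h₀ : ∀ j : Fin n, j.1 < i.1 - 1 → (Pi.single (z j) 1 : Fin n → K) ∈ G.space m := by
    have : (coordFlag K z).space m₀ ≤ G.space m := by
      rw [← h m₀ (by simp only [m₀]; omega)]
      exact G.mono (by simp only [m₀, m, Fin.mk_le_mk]; omega)
    exact (coordFlag_le_iff _ _ _).1 this
  have h₁ : ∀ j : Fin n, i.1 + 1 ≤ j.1 → v (z j) = 0 := by
    have : v ∈ (coordFlag K z).space m₁ := by
      rw [← h m₁ (by simp only [m₁]; omega)]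
      exact G.mono (by simp only [m₁, m, Fin.mk_le_mk]; omega) hv
    exact (mem_coordFlag _ _ _).1 this
  have hβ : v (z i.hi) ≠ 0 := by
    intro h0
    apply hvz
    refine (mem_coordFlag _ _ _).2 fun j hj => ?_
    rcases (show i.1 ≤ j.1 from hj).eq_or_lt with hj | hj
    · obtain rfl : j = i.hi := Fin.ext hj.symm
      exact h0
    · exact h₁ j hj
  set β := v (z i.hi)
  set α := v (z i.lo)
  -- Modulo the space of dimension `i - 1`, `v` is `β e_{z(hi)} + α e_{z(lo)}`; dividing by `β`
  -- gives the parameter.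
  refine ⟨β⁻¹ * α, hext _ (h.trans (adjacent_lineFlag z i _).symm)
    (CompleteFlag.space_eq_of_le (lineFlag_le z i _ _ h₀ ?_)).symm⟩
  have hw : v - (Pi.single (z i.hi) β + Pi.single (z i.lo) α) ∈ G.space m := by
    have : (coordFlag K z).space m₀ ≤ G.space m := (coordFlag_le_iff _ _ _).2 h₀
    refine this ((mem_coordFlag _ _ _).2 fun j hj => ?_)
    have hlh : z i.lo ≠ z i.hi := z.injective.ne i.lo_lt_hi.ne
    by_cases hj₁ : j = i.lo
    · subst hj₁
      simp [hlh, α]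
    by_cases hj₂ : j = i.hi
    · subst hj₂
      simp [hlh.symm, β]
    have e₁ : z j ≠ z i.lo := z.injective.ne hj₁
    have e₂ : z j ≠ z i.hi := z.injective.ne hj₂
    have hj' : i.1 + 1 ≤ j.1 := by
      have : j.1 ≠ i.1 - 1 := fun h => hj₁ (Fin.ext h)
      have : j.1 ≠ i.1 := fun h => hj₂ (Fin.ext h)
      simp only [m₀] at hj
      omega
    simp [e₁, e₂, h₁ j hj']
  have := (G.space m).smul_mem β⁻¹ ((G.space m).sub_mem hv hw)
  simpa [← Pi.single_smul, hβ] using this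

end Line

end BottSamelson

namespace BottSamelson

/-! ### Counting points -/

variable {K : Type*} [Field K] {n L : ℕ}

instance [Finite K] : Finite (CompleteFlag K n) :=
  Finite.of_injective CompleteFlag.space fun _ _ => CompleteFlag.ext

theorem BSVariety.ext_flag {R : Fin L → Letter n} {F G : BSVariety K R} (h : F.flag = G.flag) :
    F = G := by
  cases F; cases G; simpa using h

instance [Finite K] (R : Fin L → Letter n) : Finite (BSVariety K R) :=
  Finite.of_injective BSVariety.flag fun _ _ => BSVariety.ext_flag

theorem adjacent_coordFlag_mul (w : Equiv.Perm (Fin n)) (i : Letter n) :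
    Adjacent i (coordFlag K (w * simpleRefl i)) (coordFlag K w) := by
  have h := adjacent_lineFlag (K := K) w i 0
  have h1 : transvectionUnit (K := K) (w.injective.ne i.lo_lt_hi.ne) 0 = 1 :=
    Units.ext (Matrix.transvection_zero _ _)
  rwa [lineFlag, h1, one_smul] at h

theorem lineFlag_mem_schubertCell {z : Equiv.Perm (Fin n)} {i : Letter n}
    (hz : z i.lo < z i.hi) (c : K) : lineFlag z i c ∈ schubertCell K (z * simpleRefl i) :=
  mem_schubertCell.2 ⟨_, transvectionUnit_mem_borel hz c, rfl⟩

theorem simpleRefl_ne_one (i : Letter n) : simpleRefl i ≠ 1 := fun h =>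
  i.lo_lt_hi.ne' (by simpa using DFunLike.congr_fun h i.lo)

/-- A flag on the line of type `i` through `E^w` lies in the cell of `w` or of `w s_i`. -/
theorem mem_schubertCell_of_adjacent {w : Equiv.Perm (Fin n)} {i : Letter n}
    {G : CompleteFlag K n} (h : Adjacent i G (coordFlag K w)) :
    G ∈ schubertCell K w ∨ G ∈ schubertCell K (w * simpleRefl i) := by
  rcases lt_or_gt_of_ne (w.injective.ne i.lo_lt_hi.ne) with hlt | hgt
  · obtain rfl | ⟨c, rfl⟩ := eq_coordFlag_or_eq_lineFlag w i h
    · exact Or.inl (coordFlag_mem_schubertCell _)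
    · exact Or.inr (lineFlag_mem_schubertCell hlt c)
  · obtain rfl | ⟨c, rfl⟩ := eq_coordFlag_or_eq_lineFlag (w * simpleRefl i) i
      (h.trans (adjacent_coordFlag_mul w i).symm)
    · exact Or.inr (coordFlag_mem_schubertCell _)
    · have := lineFlag_mem_schubertCell (z := w * simpleRefl i) (i := i) (by simpa using hgt) c
      rw [mul_simpleRefl_mul_simpleRefl] at this
      exact Or.inl this

/-- The line is based at the coordinate flag of the shorter of `w` and `w s_i`: there the
transvections are upper triangular, so all remaining flags of the line fill a single cell, the
longer one. -/
theorem ncard_adjacent_coordFlag (w : Equiv.Perm (Fin n)) (i : Letter n) :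
    {G | Adjacent i (coordFlag K w) G ∧ G ∈ schubertCell K w}.ncard =
      cellFactor (Nat.card K) w i := by
  rcases lt_or_gt_of_ne (w.injective.ne i.lo_lt_hi.ne) with hlt | hgt
  · rw [cellFactor, if_pos hlt, Set.ncard_eq_one]
    refine ⟨coordFlag K w, Set.eq_singleton_iff_unique_mem.2
      ⟨⟨fun _ _ => rfl, coordFlag_mem_schubertCell _⟩, ?_⟩⟩
    rintro G ⟨hG, hGw⟩
    obtain h | ⟨c, rfl⟩ := eq_coordFlag_or_eq_lineFlag w i hG.symm
    · exact h
    · have := schubertCell_disjoint hGw (lineFlag_mem_schubertCell hlt c)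
      exact absurd (left_eq_mul.1 this) (simpleRefl_ne_one i)
  · set z := w * simpleRefl i with hz
    have hw : w = z * simpleRefl i := by simp [hz]
    have hlt : z i.lo < z i.hi := by simpa [hz] using hgt
    have hset : {G | Adjacent i (coordFlag K w) G ∧ G ∈ schubertCell K w} =
        Set.range (lineFlag (K := K) z i) := by
      ext G
      constructor
      · rintro ⟨hG, hGw⟩
        obtain rfl | ⟨c, rfl⟩ := eq_coordFlag_or_eq_lineFlag z i
          (hG.symm.trans (adjacent_coordFlag_mul w i).symm)
        · have := schubertCell_disjoint hGw (coordFlag_mem_schubertCell z)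
          exact absurd (left_eq_mul.1 this) (simpleRefl_ne_one i)
        · exact ⟨c, rfl⟩
      · rintro ⟨c, rfl⟩
        refine ⟨(adjacent_coordFlag_mul w i).symm.trans (adjacent_lineFlag z i c).symm, ?_⟩
        rw [hw]
        exact lineFlag_mem_schubertCell hlt c
    rw [hset, Set.ncard_range_of_injective (lineFlag_injective z i), cellFactor,
      if_neg hgt.not_gt]

theorem ncard_smul_adjacent (b : Matrix.GeneralLinearGroup (Fin n) K) (hb : b ∈ borel K n)
    (F : CompleteFlag K n) (w : Equiv.Perm (Fin n)) (i : Letter n) :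
    {G | Adjacent i (b • F) G ∧ G ∈ schubertCell K w}.ncard =
      {G | Adjacent i F G ∧ G ∈ schubertCell K w}.ncard := by
  rw [← Set.ncard_image_of_injective {G | Adjacent i F G ∧ G ∈ schubertCell K w}
    (MulAction.injective b)]
  congr 1
  ext G
  constructor
  · rintro ⟨hG, hGw⟩
    refine ⟨b⁻¹ • G, ⟨?_, (smul_mem_schubertCell_iff (inv_mem hb)).2 hGw⟩, smul_inv_smul _ _⟩
    simpa using hG.smul b⁻¹
  · rintro ⟨G, ⟨hG, hGw⟩, rfl⟩
    exact ⟨hG.smul b, (smul_mem_schubertCell_iff hb).2 hGw⟩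

open Classical in
/-- The number of points in the cell of `w` on the line of type `i` through a flag `F`. -/
theorem ncard_adjacent (F : CompleteFlag K n) (w : Equiv.Perm (Fin n)) (i : Letter n) :
    {G | Adjacent i F G ∧ G ∈ schubertCell K w}.ncard =
      if F ∈ schubertCell K w ∨ F ∈ schubertCell K (w * simpleRefl i) then
        cellFactor (Nat.card K) w i else 0 := by
  split_ifs with hF
  · rcases hF with hF | hF <;> obtain ⟨b, hb, rfl⟩ := mem_schubertCell.1 hF <;>
      rw [ncard_smul_adjacent b hb, ← ncard_adjacent_coordFlag]
    -- The remaining case is a translate of `E^{w s_i}`, whose line of type `i` is the line through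
    -- `E^w`.
    congr 1
    ext G
    exact and_congr_left fun _ => ⟨(adjacent_coordFlag_mul w i).symm.trans,
      (adjacent_coordFlag_mul w i).trans⟩
  · convert Set.ncard_empty (CompleteFlag K n)
    refine Set.eq_empty_of_forall_notMem ?_
    rintro G ⟨hG, hGw⟩
    obtain ⟨b, hb, rfl⟩ := mem_schubertCell.1 hGw
    have h := hG.smul b⁻¹
    rw [inv_smul_smul] at h
    have := mem_schubertCell_of_adjacent h
    rw [smul_mem_schubertCell_iff (inv_mem hb), smul_mem_schubertCell_iff (inv_mem hb)] at this
    exact hF this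

/-- A point of `BS^R` is a point of `BS^{R'}`, for `R'` the word `R` without its last letter,
together with a flag adjacent to the last one. -/
def bsEquiv (R : Fin (L + 1) → Letter n) (w : Equiv.Perm (Fin n)) :
    (bsMap K R ⁻¹' schubertCell K w) ≃
      {p : BSVariety K (fun k => R k.castSucc) × CompleteFlag K n //
        p.2 ∈ {G | Adjacent (R (Fin.last L)) (bsMap K _ p.1) G ∧ G ∈ schubertCell K w}} where
  toFun F := ⟨(⟨fun j => F.1.flag j.castSucc, F.1.flag_zero, fun r => F.1.flag_step r.castSucc⟩,
    F.1.flag (Fin.last _)), F.1.flag_step (Fin.last L), F.2⟩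
  invFun p := ⟨⟨Fin.snoc (α := fun _ => CompleteFlag K n) p.1.1.flag p.1.2, by
      rw [← Fin.castSucc_zero, Fin.snoc_castSucc]
      exact p.1.1.flag_zero, by
      intro r
      induction r using Fin.lastCases with
      | last =>
        rw [Fin.succ_last, Fin.snoc_last, Fin.snoc_castSucc]
        exact p.2.1
      | cast r =>
        rw [Fin.succ_castSucc, Fin.snoc_castSucc, Fin.snoc_castSucc]
        exact p.1.1.flag_step r⟩, by
      change Fin.snoc (α := fun _ => CompleteFlag K n) p.1.1.flag p.1.2 (Fin.last _) ∈
        schubertCell K w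
      rw [Fin.snoc_last]
      exact p.2.2⟩
  left_inv F := by
    refine Subtype.ext (BSVariety.ext_flag (funext fun j => ?_))
    induction j using Fin.lastCases with
    | last => exact Fin.snoc_last (α := fun _ => CompleteFlag K n) _ _
    | cast j => exact Fin.snoc_castSucc (α := fun _ => CompleteFlag K n) _ _ _
  right_inv p := by
    refine Subtype.ext (Prod.ext (BSVariety.ext_flag (funext fun j => ?_)) ?_)
    · exact Fin.snoc_castSucc (α := fun _ => CompleteFlag K n) _ _ _
    · exact Fin.snoc_last (α := fun _ => CompleteFlag K n) _ _

/-- The fibre of `bsEquiv` over a point of the shorter variety has `cellFactor` elements if its last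
flag lies in the cell of `w` or of `w s_i`, and is empty otherwise. These cells are disjoint, so the
base points add up. -/
theorem ncard_preimage_succ [Finite K] (R : Fin (L + 1) → Letter n) (w : Equiv.Perm (Fin n)) :
    (bsMap K R ⁻¹' schubertCell K w).ncard = cellFactor (Nat.card K) w (R (Fin.last L)) *
      ((bsMap K (fun k => R k.castSucc) ⁻¹' schubertCell K w).ncard +
        (bsMap K (fun k => R k.castSucc) ⁻¹'
          schubertCell K (w * simpleRefl (R (Fin.last L)))).ncard) := by
  classical
  have := Fintype.ofFinite (BSVariety K fun k => R k.castSucc)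
  rw [← Nat.card_coe_set_eq, Nat.card_congr ((bsEquiv R w).trans
    (Equiv.subtypeProdEquivSigmaSubtype fun F G => G ∈ {G | Adjacent (R (Fin.last L))
      (bsMap K (fun k => R k.castSucc) F) G ∧ G ∈ schubertCell K w})), Nat.card_sigma]
  have h : ∀ F : BSVariety K fun k => R k.castSucc,
      Nat.card {G // G ∈ {G | Adjacent (R (Fin.last L)) (bsMap K _ F) G ∧
        G ∈ schubertCell K w}} = _ := fun F =>
    (Nat.card_coe_set_eq _).trans (ncard_adjacent _ w (R (Fin.last L)))
  rw [Finset.sum_congr rfl fun F _ => h F, ← Finset.sum_filter, Finset.sum_const, smul_eq_mul,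
    mul_comm, ← Set.ncard_union_eq, ← Set.ncard_coe_finset]
  · congr 2
    ext F
    simp
  · refine Set.disjoint_left.2 fun F hF hF' => ?_
    exact simpleRefl_ne_one _ (left_eq_mul.1 (schubertCell_disjoint hF hF'))

theorem ncard_preimage_zero (R : Fin 0 → Letter n) (w : Equiv.Perm (Fin n)) :
    (bsMap K R ⁻¹' schubertCell K w).ncard = if w = 1 then 1 else 0 := by
  have hlast : ∀ F : BSVariety K R, bsMap K R F = coordFlag K 1 := fun F => F.flag_zero
  split_ifs with hw
  · subst hw
    refine Set.ncard_eq_one.2 ⟨⟨fun _ => stdFlag K n, rfl, fun r => r.elim0⟩,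
      Set.eq_singleton_iff_unique_mem.2 ⟨coordFlag_mem_schubertCell _, fun F _ =>
        BSVariety.ext_flag (funext fun j => ?_)⟩⟩
    rw [Subsingleton.elim (α := Fin 1) j 0]
    exact F.flag_zero
  · convert Set.ncard_empty (BSVariety K R)
    refine Set.eq_empty_of_forall_notMem fun F hF => hw ?_
    rw [Set.mem_preimage, hlast] at hF
    exact schubertCell_disjoint hF (coordFlag_mem_schubertCell 1)

/-- `|π_R⁻¹(X_w°)| = wt_R(w)`. -/
theorem ncard_preimage_eq_weight [Finite K] (R : Fin L → Letter n) (w : Equiv.Perm (Fin n)) :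
    (bsMap K R ⁻¹' schubertCell K w).ncard = weight (Nat.card K) R w := by
  induction L generalizing w with
  | zero => rw [ncard_preimage_zero, weight_zero]
  | succ L ih => rw [ncard_preimage_succ, weight_succ, ih, ih]

end BottSamelson

theorem mainTheorem2 (K : Type*) [Field K] [Finite K] (q : ℕ) (hq : Nat.card K = q)
    (n L : ℕ) (R : Fin L → BottSamelson.Letter n) (w : Equiv.Perm (Fin n)) :
    (BottSamelson.bsMap K R ⁻¹' BottSamelson.schubertCell K w).ncard =
        BottSamelson.weight q R w ∧
      BottSamelson.bsProb K R w = BottSamelson.weight (q : ℝ) R w / (1 + (q : ℝ)) ^ L := by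
  subst hq
  refine ⟨BottSamelson.ncard_preimage_eq_weight R w, ?_⟩
  rw [BottSamelson.bsProb, BottSamelson.ncard_preimage_eq_weight, BottSamelson.weight_natCast,
    add_comm (1 : ℝ)]
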